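/- **Setting.** A *commutative semiring* $(\mathbb S,+,\cdot,0,1)$ is *zero-sum free* if $s+s'=0$ implies $s=s'=0$. For a ranked alphabet $\Sigma$ (a finite set of symbols with ranks) and a set $Z$, let $T_\Sigma(Z)$ be the set of $\Sigma$-trees indexed by $Z$, and $T_\Sigma=T_\Sigma(\emptyset)$. Positions of trees are words over $\mathbb N$ (children are numbered from $1$), and $t|_w$ is the subtree of $t$ at position $w$. A *weighted tree grammar with constraints* (WTGc) over $\Sigma$ and $\mathbb S$ is a tuple $G=(Q,\Sigma,F,P,\mathrm{wt})$ with a finite set $Q$ of nonterminals, final weights $F\in\mathbb S^Q$, a finite set $P$ of productions $(\ell,q,E,I)$, where $\ell\in T_\Sigma(Q)\setminus Q$, $q\in Q$ and $E,I\subseteq\mathbb N^*\times\mathbb N^*$ are finite (the equality and the inequality constraints), and weights $\mathrm{wt}\in\mathbb S^P$. A tree $t$ satisfies $(v,v')$ if $v$ and $v'$ are positions of $t$ and $t|_v=t|_{v'}$. For an input tree $t\in T_\Sigma$, a production $p=(\ell,q,E,I)$ may be applied to $\xi\in T_\Sigma(Q)$ at a position $w$ if $\xi|_w=\ell$, $t|_w$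 satisfies all elements of $E$, and $t|_w$ satisfies no element of $I$; it replaces the subtree of $\xi$ at $w$ by $q$. A complete left-most derivation for $t$ to $q\in Q$ is a sequence $(p_1,w_1)\cdots(p_n,w_n)$ of such steps leading from $t$ to $q$ with $w_1\prec\dots\prec w_n$, where $\prec$ is the lexicographic order in which prefixes are larger. Its weight is $\prod_i \mathrm{wt}(p_i)$, and $G$ generates the weighted tree language $T_\Sigma\to\mathbb S$ that maps $t$ to the sum of $F_q\cdot\mathrm{wt}(d)$ over all $q\in Q$ and all complete left-most derivations $d$ for $t$ to $q$. $G$ is *positive* if $I=\emptyset$ in every production; a weighted tree language is *positive constraint-regular* if it is generated by a positive WTGc. $G$ is *classic* if in every production all constraints $(v,v')\in E\cup I$ refer to positions $v,v'$ of $\ell$ that are labeled by nonterminals. A nonterminal $\bot$ is a *sink nonterminal* if $F_\bot=0$, every production $\sigma(\bot,\dots,\bot)\to\bot$ with $\sigma\in\Sigma$ (without constraints) is in $P$ with weight $1$, and no other production has target $\bot$. A classic WTGc is *eq-restricted* if it has a sink nonterminal $\bot$ such that for every production $(\ell,q,E,I)\in P$ and every class, with respect to the equivalence relation generated by $E$,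 of nonterminal-labeled positions of $\ell$, there is $q'\in Q$ such that all labels in the class are in $\{q',\bot\}$ and exactly one position in the class is labeled $q'$. **Proposition.** Let $\mathbb S$ be a zero-sum free commutative semiring with $0\neq1$. Then the class of weighted tree languages over $\mathbb S$ (over arbitrary ranked alphabets) that are generated by eq-restricted, positive, and classic WTGc is strictly contained in the class of positive constraint-regular weighted tree languages over $\mathbb S$. Specifically, let $\Sigma=\{f^{(2)},\underline f^{(2)},g^{(2)},a^{(0)}\}$, and let $G$ be the positive WTGc with nonterminals $q,q'$, final weights $F_q=1$ and $F_{q'}=0$, and the productions $$a\to q',\qquad g(q',q')\to q,\qquad f(q,q)\xrightarrow{12=21}q,\qquad \underline f(q,q)\xrightarrow{12=21}q,$$ each of weight $1$. Then the weighted tree language generated by $G$ is not generated by any eq-restricted, positive, and classic WTGc. -/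

import Mathlib

/-- A ranked alphabet: a finite set of symbols, each with a rank. -/
structure RankedAlphabet where
  Sym : Type
  finite_sym : Finite Sym
  rk : Sym → ℕ

/-- The set `T_Σ(Z)` of `Σ`-trees indexed by `Z`. -/
inductive RTree (A : RankedAlphabet) (Z : Type) : Type
  | leaf (z : Z) : RTree A Z
  | node (a : A.Sym) (ts : Fin (A.rk a) → RTree A Z) : RTree A Z

/-- The set `T_Σ = T_Σ(∅)`. -/
abbrev GroundTree (A : RankedAlphabet) : Type := RTree A Empty

namespace RTree

variable {A : RankedAlphabet} {Z : Type}

/-- The inclusion of `T_Σ` into `T_Σ(Z)`. -/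
def ofGround : GroundTree A → RTree A Z
  | leaf e => e.elim
  | node a ts => node a fun i => ofGround (ts i)

/-- The subtree `t|_w`, where children are numbered `1, …, k`; it is `none` exactly if `w` is not a
position of `t`. -/
def subtreeAt : RTree A Z → List ℕ → Option (RTree A Z)
  | t, [] => some t
  | leaf _, _ :: _ => none
  | node a ts, i :: w =>
      if h : 1 ≤ i ∧ i ≤ A.rk a then subtreeAt (ts ⟨i - 1, by omega⟩) w else none

/-- The substitution `t[u]_w` of `u` into `t` at the position `w` (only used for positions `w`
of `t`). -/
def replaceAt : RTree A Z → List ℕ → RTree A Z → RTree A Z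
  | _, [], u => u
  | leaf z, _ :: _, _ => leaf z
  | node a ts, i :: w, u =>
      if h : 1 ≤ i ∧ i ≤ A.rk a then
        node a (Function.update ts ⟨i - 1, by omega⟩ (replaceAt (ts ⟨i - 1, by omega⟩) w u))
      else node a ts

/-- `t` satisfies the constraint `(v, v')`: both are positions of `t`, and `t|_v = t|_v'`. -/
def Satisfies (t : RTree A Z) (c : List ℕ × List ℕ) : Prop :=
  ∃ s, t.subtreeAt c.1 = some s ∧ t.subtreeAt c.2 = some s

theorem finite_positions (t : RTree A Z) : {w | ∃ s, t.subtreeAt w = some s}.Finite := by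
  induction t with
  | leaf z =>
    refine (Set.finite_singleton ([] : List ℕ)).subset ?_
    rintro (_ | ⟨i, w⟩) ⟨s, hs⟩
    · rfl
    · simp [subtreeAt] at hs
  | node a ts ih =>
    refine ((Set.finite_singleton ([] : List ℕ)).union
      (Set.finite_iUnion fun i : Fin (A.rk a) => (ih i).image (List.cons (i.1 + 1)))).subset ?_
    rintro (_ | ⟨i, w⟩) ⟨s, hs⟩
    · exact Or.inl rfl
    · right
      by_cases h : 1 ≤ i ∧ i ≤ A.rk a
      · simp only [subtreeAt, h, and_self, dite_true] at hs
        refine Set.mem_iUnion.2 ⟨⟨i - 1, by omega⟩, w, ⟨s, hs⟩, ?_⟩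
        have : i - 1 + 1 = i := by omega
        simp [this]
      · simp [subtreeAt, h] at hs

end RTree

/-- The lexicographic order `≺` on positions in which prefixes are larger. -/
def PosLT : List ℕ → List ℕ → Prop
  | [], _ => False
  | _ :: _, [] => True
  | i :: v, j :: w => i < j ∨ (i = j ∧ PosLT v w)

theorem PosLT.irrefl : ∀ v : List ℕ, ¬ PosLT v v
  | [] => id
  | i :: v => by
    rintro (h | ⟨-, h⟩)
    · exact lt_irrefl i h
    · exact PosLT.irrefl v h

/-- A production `ℓ → q` with finite sets `E` of equality constraints and `I` of inequality
constraints; its left-hand side is not a nonterminal. -/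
structure WTGcProduction (A : RankedAlphabet) (N : Type) where
  lhs : RTree A N
  target : N
  eqs : Finset (List ℕ × List ℕ)
  neqs : Finset (List ℕ × List ℕ)
  lhs_ne_leaf : ∀ q : N, lhs ≠ RTree.leaf q

namespace WTGcProduction

variable {A : RankedAlphabet} {N : Type}

def IsPositive (p : WTGcProduction A N) : Prop := p.neqs = ∅

/-- `v` is a position of the left-hand side that is labeled by the nonterminal `q`. -/
def NonterminalAt (p : WTGcProduction A N) (v : List ℕ) (q : N) : Prop :=
  p.lhs.subtreeAt v = some (RTree.leaf q)

/-- All constraints refer to nonterminal-labeled positions of the left-hand side. -/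
def IsClassic (p : WTGcProduction A N) : Prop :=
  ∀ c, c ∈ p.eqs ∨ c ∈ p.neqs → (∃ q, p.NonterminalAt c.1 q) ∧ ∃ q, p.NonterminalAt c.2 q

/-- The equivalence relation generated by the equality constraints. For a classic production it
relates a nonterminal-labeled position only to nonterminal-labeled positions. -/
def EqClosure (p : WTGcProduction A N) : List ℕ → List ℕ → Prop :=
  Relation.EqvGen fun v w => (v, w) ∈ p.eqs

/-- The unconstrained production `σ(b, …, b) → b`. -/
def sink (b : N) (a : A.Sym) : WTGcProduction A N where
  lhs := RTree.node a fun _ => RTree.leaf b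
  target := b
  eqs := ∅
  neqs := ∅
  lhs_ne_leaf := by intro q h; cases h

end WTGcProduction

/-- A weighted tree grammar with constraints over the ranked alphabet `A` and the semiring `S`. -/
structure WTGc (A : RankedAlphabet) (S : Type*) where
  N : Type
  [fintypeN : Fintype N]
  final : N → S
  prods : Set (WTGcProduction A N)
  finite_prods : prods.Finite
  wt : prods → S

namespace WTGc

variable {A : RankedAlphabet} {S : Type*}

/-- The derivation step from `ξ` to `ζ` by the production `p` at position `w`, for the input
tree `t`. -/
structure Step (G : WTGc A S) (t : GroundTree A) (p : G.prods) (w : List ℕ)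
    (ξ ζ : RTree A G.N) : Prop where
  redex : ξ.subtreeAt w = some p.1.lhs
  result : ζ = ξ.replaceAt w (RTree.leaf p.1.target)
  constraints : ∃ s, t.subtreeAt w = some s ∧
    (∀ c ∈ p.1.eqs, s.Satisfies c) ∧ ∀ c ∈ p.1.neqs, ¬ s.Satisfies c

/-- `G.Derives t ξ d ζ`: the sequence `d` of derivation steps for the input tree `t` leads from
`ξ` to `ζ`. -/
inductive Derives (G : WTGc A S) (t : GroundTree A) :
    RTree A G.N → List (G.prods × List ℕ) → RTree A G.N → Prop
  | nil (ξ : RTree A G.N) : Derives G t ξ [] ξ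
  | cons {ξ ζ χ : RTree A G.N} {p : G.prods} {w : List ℕ} {d : List (G.prods × List ℕ)} :
      G.Step t p w ξ ζ → Derives G t ζ d χ → Derives G t ξ ((p, w) :: d) χ

/-- The set of all complete left-most derivations for `t` to the nonterminal `q`. -/
def derivations (G : WTGc A S) (q : G.N) (t : GroundTree A) : Set (List (G.prods × List ℕ)) :=
  {d | d.Pairwise (fun x y => PosLT x.2 y.2) ∧ G.Derives t t.ofGround d (RTree.leaf q)}

theorem Derives.isPos {G : WTGc A S} {t : GroundTree A} {ξ ζ : RTree A G.N}
    {d : List (G.prods × List ℕ)} (h : G.Derives t ξ d ζ) :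
    ∀ x ∈ d, ∃ s, t.subtreeAt x.2 = some s := by
  induction h with
  | nil => simp
  | cons hs _ ih =>
    obtain ⟨s, hs, -⟩ := hs.constraints
    intro x hx
    rcases List.mem_cons.1 hx with rfl | hx
    · exact ⟨s, hs⟩
    · exact ih x hx

theorem finite_derivations (G : WTGc A S) (q : G.N) (t : GroundTree A) :
    (G.derivations q t).Finite := by
  classical
  have : Finite G.prods := G.finite_prods
  have hX : {x : G.prods × List ℕ | ∃ s, t.subtreeAt x.2 = some s}.Finite :=
    (Set.finite_univ.prod t.finite_positions).subset fun x hx => ⟨Set.mem_univ _, hx⟩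
  have : Fintype {x : G.prods × List ℕ | ∃ s, t.subtreeAt x.2 = some s} := hX.fintype
  refine (Set.finite_range fun l : {l : List {x : G.prods × List ℕ | ∃ s, t.subtreeAt x.2 = some s} //
    l.Nodup} => l.1.map Subtype.val).subset ?_
  rintro d ⟨hd, hder⟩
  have hmap : (d.pmap (fun x hx => (⟨x, hx⟩ : {x : G.prods × List ℕ | ∃ s, t.subtreeAt x.2 = some s}))
      hder.isPos).map Subtype.val = d := by
    rw [List.map_pmap]
    exact (List.pmap_eq_map (f := id) hder.isPos).trans (List.map_id d)
  refine ⟨⟨_, ?_⟩, hmap⟩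
  refine List.Nodup.of_map Subtype.val ?_
  rw [hmap]
  exact List.Pairwise.imp (fun h e => by subst e; exact PosLT.irrefl _ h) hd

/-- The weight of a derivation. -/
def derivationWeight (G : WTGc A S) [CommSemiring S] (d : List (G.prods × List ℕ)) : S :=
  (d.map fun x => G.wt x.1).prod

/-- The weighted tree language generated by `G`. -/
noncomputable def language (G : WTGc A S) [CommSemiring S] (t : GroundTree A) : S :=
  letI := G.fintypeN
  ∑ q : G.N, ∑ d ∈ (G.finite_derivations q t).toFinset, G.final q * G.derivationWeight d

def IsPositive (G : WTGc A S) : Prop := ∀ p ∈ G.prods, p.IsPositive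

def IsClassic (G : WTGc A S) : Prop := ∀ p ∈ G.prods, p.IsClassic

/-- `b` is a sink nonterminal: its final weight is `0`, every production `σ(b, …, b) → b` is present
with weight `1`, and no other production has target `b`. -/
def IsSinkNonterminal (G : WTGc A S) [CommSemiring S] (b : G.N) : Prop :=
  G.final b = 0 ∧
  (∀ a : A.Sym, ∃ h : WTGcProduction.sink b a ∈ G.prods, G.wt ⟨_, h⟩ = 1) ∧
  ∀ p ∈ G.prods, p.target = b → ∃ a : A.Sym, p = WTGcProduction.sink b a

/-- A classic grammar is eq-restricted if, for some sink nonterminal `b`, in every production and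
for every class of nonterminal-labeled positions of its left-hand side that are linked by equality
constraints there is a nonterminal `q'` such that all positions in the class are labeled `q'` or
`b`, and exactly one of them is labeled `q'`. -/
def IsEqRestricted (G : WTGc A S) [CommSemiring S] : Prop :=
  G.IsClassic ∧ ∃ b : G.N, G.IsSinkNonterminal b ∧
    ∀ p ∈ G.prods, ∀ v, (∃ q, p.NonterminalAt v q) →
      ∃ q' : G.N,
        (∀ w, p.EqClosure v w → p.NonterminalAt w q' ∨ p.NonterminalAt w b) ∧
        ∃! w, p.EqClosure v w ∧ p.NonterminalAt w q'

end WTGc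

/-- A weighted tree language over `S`, together with its ranked alphabet. -/
abbrev WeightedTreeLanguage (S : Type*) := Σ A : RankedAlphabet, (GroundTree A → S)

/-- The class of positive constraint-regular weighted tree languages. -/
def positiveConstraintRegular (S : Type*) [CommSemiring S] : Set (WeightedTreeLanguage S) :=
  {L | ∃ G : WTGc L.1 S, G.IsPositive ∧ G.language = L.2}

/-- The class of weighted tree languages generated by eq-restricted, positive, and classic
grammars. -/
def eqRestrictedPositiveClassic (S : Type*) [CommSemiring S] : Set (WeightedTreeLanguage S) :=
  {L | ∃ G : WTGc L.1 S, G.IsEqRestricted ∧ G.IsPositive ∧ G.IsClassic ∧ G.language = L.2}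

/-- A semiring is zero-sum free if a sum is zero only if both summands are. -/
def IsZeroSumFree (S : Type*) [CommSemiring S] : Prop :=
  ∀ s s' : S, s + s' = 0 → s = 0 ∧ s' = 0

/-- The symbols `f`, `f̲`, `g`, `a`. -/
inductive WitnessSym : Type
  | f | fUnderlined | g | a

/-- The ranked alphabet `{f⁽²⁾, f̲⁽²⁾, g⁽²⁾, a⁽⁰⁾}`. -/
def witnessAlphabet : RankedAlphabet where
  Sym := WitnessSym
  finite_sym := Finite.of_surjective
    (![WitnessSym.f, WitnessSym.fUnderlined, WitnessSym.g, WitnessSym.a] : Fin 4 → WitnessSym)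
    fun
      | .f => ⟨0, rfl⟩
      | .fUnderlined => ⟨1, rfl⟩
      | .g => ⟨2, rfl⟩
      | .a => ⟨3, rfl⟩
  rk
    | .f => 2
    | .fUnderlined => 2
    | .g => 2
    | .a => 0

/-- The nonterminals `q` and `q'`. -/
inductive WitnessNT : Type
  | q | q'

/-- The production `σ(r, …, r) → r'` with the equality constraints `E`. -/
def witnessProduction (σ : WitnessSym) (r r' : WitnessNT) (E : Finset (List ℕ × List ℕ)) :
    WTGcProduction witnessAlphabet WitnessNT where
  lhs := RTree.node (A := witnessAlphabet) σ fun _ => RTree.leaf r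
  target := r'
  eqs := E
  neqs := ∅
  lhs_ne_leaf := by intro s h; cases h

/-- The grammar with final weights `1` for `q` and `0` for `q'`, and with the productions `a → q'`,
`g(q', q') → q`, `f(q, q) → q` and `f̲(q, q) → q`, the last two with the constraint `12 = 21`, all
of weight `1`. -/
def witnessGrammar (S : Type*) [CommSemiring S] : WTGc witnessAlphabet S where
  N := WitnessNT
  fintypeN := ⟨⟨{WitnessNT.q, WitnessNT.q'}, by simp⟩, by rintro (_ | _) <;> simp⟩
  final
    | .q => 1
    | .q' => 0
  prods :=
    { witnessProduction .a .q .q' ∅,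
      witnessProduction .g .q' .q ∅,
      witnessProduction .f .q .q {([1, 2], [2, 1])},
      witnessProduction .fUnderlined .q .q {([1, 2], [2, 1])} }
  finite_prods := Set.toFinite _
  wt := fun _ => 1

/-!
In the language of the witness grammar the subtrees `t|12` and `t|21` agree at every position above
`f` or `f̲`, so the two direct subtrees at such a position have a part in common, even if
they are distinct. An eq-restricted classic grammar can only duplicate whole subtrees, and hence
cannot enforce this.

The trees `altTree n b` are generated by the witness grammar, and in them siblings above the symbols
`g` are distinct. Suppose that an eq-restricted, positive, and classic grammar generates the same
language. For each `n` it has a derivation of nonzero weight for `altTree n true`; for infinitely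
many `n` the last production `ℓ → q` is the same. If `n` is large, some siblings `u1`, `u2` in `ℓ`
are nonterminals (`exists_sibling_leaves`), and since their subtrees are distinct, they are
not linked by the constraints. The class of `u1` has just one position `v` that is labeled by the
nonterminal of the class, and there this nonterminal produces `altTree n true|u1` for infinitely
many `n`.

The semiring may have zero divisors, so the exchange of two such subderivations need not preserve
nonzero weights. By Dickson's lemma (`WTGc.exists_lt_multiset_le`) there are, however, two heights
`n < n'` such that the productions below `v` for `n` form a submultiset of those for `n'`. Replacing
the subtrees in the class of `u1` for `n'` by the one for `n` yields a derivation whose weight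
divides the former one (`WTGc.Run.exchange`), and so is nonzero. As `S` is zero-sum free, the new
tree is generated. But the subtree at `u12` now has a height different from the one at `u21`, which
is impossible in the language of the witness grammar (`WTGc.Run.subtreeAt_eq`).

The order of the steps of a left-most derivation is irrelevant for this argument. The predicate
`WTGc.Run` records only which productions are used and how often; `WTGc.Derives.run` and
`WTGc.Run.exists_derives` relate it to derivations.
-/

/-! ### Subtrees and substitution -/

namespace RTree

variable {A : RankedAlphabet} {Z : Type}

theorem subtreeAt_nil (t : RTree A Z) : t.subtreeAt [] = some t := by
  cases t <;> rfl

theorem replaceAt_nil (t u : RTree A Z) : t.replaceAt [] u = u := by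
  cases t <;> rfl

theorem subtreeAt_node_succ (a : A.Sym) (ts : Fin (A.rk a) → RTree A Z) (i : Fin (A.rk a))
    (w : List ℕ) : (node a ts).subtreeAt ((i.1 + 1) :: w) = (ts i).subtreeAt w := by
  have h : 1 ≤ i.1 + 1 ∧ i.1 + 1 ≤ A.rk a := ⟨by omega, i.2⟩
  simp [subtreeAt, h]

theorem replaceAt_node_succ (a : A.Sym) (ts : Fin (A.rk a) → RTree A Z) (i : Fin (A.rk a))
    (w : List ℕ) (u : RTree A Z) : (node a ts).replaceAt ((i.1 + 1) :: w) u =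
      node a (Function.update ts i ((ts i).replaceAt w u)) := by
  have h : 1 ≤ i.1 + 1 ∧ i.1 + 1 ≤ A.rk a := ⟨by omega, i.2⟩
  simp [replaceAt, h]

theorem exists_of_subtreeAt_cons {t s : RTree A Z} {i : ℕ} {w : List ℕ}
    (h : t.subtreeAt (i :: w) = some s) :
    ∃ a ts, t = node a ts ∧ ∃ j : Fin (A.rk a), i = j.1 + 1 ∧ (ts j).subtreeAt w = some s := by
  cases t with
  | leaf z => simp [subtreeAt] at h
  | node a ts =>
    by_cases hi : 1 ≤ i ∧ i ≤ A.rk a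
    · refine ⟨a, ts, rfl, ⟨i - 1, by omega⟩, by simp; omega, ?_⟩
      simpa [subtreeAt, hi] using h
    · simp [subtreeAt, hi] at h

theorem subtreeAt_append (t : RTree A Z) (u w : List ℕ) :
    t.subtreeAt (u ++ w) = (t.subtreeAt u).bind fun s => s.subtreeAt w := by
  induction u generalizing t with
  | nil => simp [subtreeAt_nil]
  | cons i u ih =>
    cases t with
    | leaf z => simp [subtreeAt]
    | node a ts =>
      by_cases hi : 1 ≤ i ∧ i ≤ A.rk a
      · simp [subtreeAt, hi, ih]
      · simp [subtreeAt, hi]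

/-- The ground tree obtained from `l` by replacing the leaf at each position `w` that is labeled by
an element of `Z` by the tree `τ w`. -/
def plug : RTree A Z → (List ℕ → GroundTree A) → GroundTree A
  | leaf _, τ => τ []
  | node a ts, τ => node a fun i => (ts i).plug fun w => τ ((i.1 + 1) :: w)

/-- The sum of `μ w` over all positions `w` of `l` that are labeled by an element of `Z`. -/
def leafSum {M : Type*} [AddCommMonoid M] : RTree A Z → (List ℕ → M) → M
  | leaf _, μ => μ []
  | node _ ts, μ => ∑ i, (ts i).leafSum fun w => μ ((i.1 + 1) :: w)

theorem subtreeAt_plug {l : RTree A Z} {w : List ℕ} {z : Z} (τ : List ℕ → GroundTree A)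
    (h : l.subtreeAt w = some (leaf z)) : (l.plug τ).subtreeAt w = some (τ w) := by
  induction w generalizing l τ with
  | nil =>
    rw [subtreeAt_nil] at h
    cases h
    exact subtreeAt_nil _
  | cons i w ih =>
    obtain ⟨a, ts, rfl, j, rfl, h'⟩ := exists_of_subtreeAt_cons h
    rw [plug, subtreeAt_node_succ]
    exact ih _ h'

theorem Satisfies.subtreeAt_eq {t : RTree A Z} {c : List ℕ × List ℕ} (h : t.Satisfies c) :
    t.subtreeAt c.1 = t.subtreeAt c.2 := by
  obtain ⟨s, h₁, h₂⟩ := h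
  rw [h₁, h₂]

end RTree

/-! ### Runs and left-most derivations -/

namespace WTGc

open RTree

variable {A : RankedAlphabet} {S : Type*}

/-- `G.Run t ξ m`: the input tree `t` can be reduced to `ξ` by derivation steps in which the
productions are used with the multiplicities given by `m`. The order of the steps is left out, so
that runs on the direct subtrees can be combined and exchanged freely. -/
inductive Run (G : WTGc A S) : GroundTree A → RTree A G.N → Multiset G.prods → Prop
  | node (a : A.Sym) (ts : Fin (A.rk a) → GroundTree A) (ξs : Fin (A.rk a) → RTree A G.N)
      (ms : Fin (A.rk a) → Multiset G.prods) :
      (∀ i, Run G (ts i) (ξs i) (ms i)) → Run G (.node a ts) (.node a ξs) (∑ i, ms i)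
  | prod (t : GroundTree A) (p : G.prods) (m : Multiset G.prods) :
      Run G t p.1.lhs m → (∀ c ∈ p.1.eqs, t.Satisfies c) → (∀ c ∈ p.1.neqs, ¬ t.Satisfies c) →
      Run G t (.leaf p.1.target) (p ::ₘ m)

variable {G : WTGc A S}

theorem Run.exists_of_node {t : GroundTree A} {a : A.Sym} {ξs : Fin (A.rk a) → RTree A G.N}
    {m : Multiset G.prods} (h : G.Run t (.node a ξs) m) :
    ∃ (ts : Fin (A.rk a) → GroundTree A) (ms : Fin (A.rk a) → Multiset G.prods),
      t = .node a ts ∧ m = ∑ i, ms i ∧ ∀ i, G.Run (ts i) (ξs i) (ms i) := by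
  cases h with
  | node _ ts _ ms h => exact ⟨ts, ms, rfl, rfl, h⟩

theorem Run.exists_of_leaf {t : GroundTree A} {q : G.N} {m : Multiset G.prods}
    (h : G.Run t (.leaf q) m) :
    ∃ (p : G.prods) (m' : Multiset G.prods), p.1.target = q ∧ m = p ::ₘ m' ∧ G.Run t p.1.lhs m' ∧
      (∀ c ∈ p.1.eqs, t.Satisfies c) ∧ ∀ c ∈ p.1.neqs, ¬ t.Satisfies c := by
  cases h with
  | prod _ p m h h₁ h₂ => exact ⟨p, m, rfl, rfl, h, h₁, h₂⟩

theorem run_ofGround (t : GroundTree A) : G.Run t t.ofGround 0 := by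
  induction t with
  | leaf e => exact e.elim
  | node a ts ih => simpa [ofGround] using Run.node a ts _ _ ih

theorem Run.step {t : GroundTree A} {p : G.prods} {w : List ℕ} {ξ ζ : RTree A G.N}
    {m : Multiset G.prods} (h : G.Run t ξ m) (hs : G.Step t p w ξ ζ) : G.Run t ζ (p ::ₘ m) := by
  obtain ⟨hr, rfl, s, hts, hc⟩ := hs
  induction w generalizing t ξ m with
  | nil =>
    rw [subtreeAt_nil] at hr hts
    cases hr
    cases hts
    rw [replaceAt_nil]
    exact Run.prod _ _ _ h hc.1 hc.2
  | cons i w ih =>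
    obtain ⟨a, ξs, rfl, j, rfl, hj⟩ := exists_of_subtreeAt_cons hr
    obtain ⟨ts, ms, rfl, rfl, hrun⟩ := h.exists_of_node
    rw [subtreeAt_node_succ] at hts
    rw [replaceAt_node_succ]
    have hm : p ::ₘ ∑ k, ms k = ∑ k, Function.update ms j (p ::ₘ ms j) k := by
      rw [Finset.sum_update_of_mem (Finset.mem_univ j), Multiset.cons_add,
        ← Finset.add_sum_erase _ _ (Finset.mem_univ j), Finset.sdiff_singleton_eq_erase]
    rw [hm]
    refine Run.node _ _ _ _ fun k => ?_
    rcases eq_or_ne k j with rfl | hk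
    · simpa using ih (hrun k) hj hts
    · simpa [hk] using hrun k

theorem Derives.run {t : GroundTree A} {ξ ζ : RTree A G.N} {d : List (G.prods × List ℕ)}
    {m : Multiset G.prods} (hd : G.Derives t ξ d ζ) (h : G.Run t ξ m) :
    G.Run t ζ (↑(d.map Prod.fst) + m) := by
  induction hd generalizing m with
  | nil => simpa using h
  | cons hs _ ih =>
    rw [List.map_cons, ← Multiset.cons_coe, Multiset.cons_add, ← Multiset.add_cons]
    exact ih (h.step hs)

theorem Derives.append {t : GroundTree A} {ξ ζ χ : RTree A G.N} {d e : List (G.prods × List ℕ)}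
    (h : G.Derives t ξ d ζ) (h' : G.Derives t ζ e χ) : G.Derives t ξ (d ++ e) χ := by
  induction h with
  | nil => exact h'
  | cons hs _ ih => exact .cons hs (ih h')

/-- A derivation on the `i`-th direct subtree is a derivation on the whole tree. -/
theorem Derives.lift {a : A.Sym} {ts : Fin (A.rk a) → GroundTree A} {i : Fin (A.rk a)}
    {ξ ζ : RTree A G.N} {d : List (G.prods × List ℕ)} (h : G.Derives (ts i) ξ d ζ)
    (ξs : Fin (A.rk a) → RTree A G.N) :
    G.Derives (.node a ts) (.node a (Function.update ξs i ξ))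
      (d.map fun x => (x.1, (i.1 + 1) :: x.2)) (.node a (Function.update ξs i ζ)) := by
  induction h with
  | nil => exact .nil _
  | cons hs _ ih =>
    refine .cons ⟨?_, ?_, ?_⟩ ih
    · rw [subtreeAt_node_succ]
      simpa using hs.redex
    · rw [replaceAt_node_succ]
      simp [hs.result]
    · rw [subtreeAt_node_succ]
      exact hs.constraints

/-- Derivations on the direct subtrees can be concatenated from left to right. -/
theorem exists_derives_node {a : A.Sym} (ts : Fin (A.rk a) → GroundTree A)
    (ζs ξs : Fin (A.rk a) → RTree A G.N) (ds : Fin (A.rk a) → List (G.prods × List ℕ))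
    (hp : ∀ i, (ds i).Pairwise fun x y => PosLT x.2 y.2)
    (hd : ∀ i, G.Derives (ts i) (ζs i) (ds i) (ξs i)) :
    ∃ d : List (G.prods × List ℕ), d.Pairwise (fun x y => PosLT x.2 y.2) ∧
      G.Derives (.node a ts) (.node a ζs) d (.node a ξs) ∧
      (d.map Prod.fst : Multiset G.prods) = ∑ i, ((ds i).map Prod.fst : Multiset G.prods) ∧
      ∀ x ∈ d, x.2 ≠ [] := by
  -- the first `k` subtrees have been reduced
  have key : ∀ k ≤ A.rk a, ∃ d : List (G.prods × List ℕ),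
      d.Pairwise (fun x y => PosLT x.2 y.2) ∧
      G.Derives (.node a ts) (.node a ζs) d (.node a fun i => if i.1 < k then ξs i else ζs i) ∧
      (d.map Prod.fst : Multiset G.prods) =
        ∑ i with i.1 < k, ((ds i).map Prod.fst : Multiset G.prods) ∧
      ∀ x ∈ d, ∃ i w, x.2 = i :: w ∧ i ≤ k := by
    intro k
    induction k with
    | zero => exact fun _ => ⟨[], by simp, by simpa using Derives.nil _, by simp, by simp⟩
    | succ k ih =>
      intro hk
      obtain ⟨d, h₁, h₂, h₃, h₄⟩ := ih (by omega)
      let j : Fin (A.rk a) := ⟨k, hk⟩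
      refine ⟨d ++ (ds j).map fun x => (x.1, (j.1 + 1) :: x.2), ?_, ?_, ?_, ?_⟩
      · rw [List.pairwise_append]
        refine ⟨h₁, List.pairwise_map.2 ((hp j).imp fun h => Or.inr ⟨rfl, h⟩), ?_⟩
        intro x hx y hy
        obtain ⟨i, w, hi, hik⟩ := h₄ x hx
        obtain ⟨y, -, rfl⟩ := List.mem_map.1 hy
        rw [hi]
        exact Or.inl (Nat.lt_succ_of_le hik)
      · refine h₂.append ?_
        have := (hd j).lift fun i => if i.1 < k then ξs i else ζs i
        convert this using 2
        · funext i
          rcases eq_or_ne i j with rfl | hi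
          · simp [j]
          · simp [hi]
        · funext i
          rcases eq_or_ne i j with rfl | hi
          · simp [j]
          · have : i.1 ≠ k := fun h => hi (Fin.ext h)
            have : i.1 < k + 1 ↔ i.1 < k := by omega
            simp [hi, this]
      · have : (Finset.univ.filter fun i : Fin (A.rk a) => i.1 < k + 1) =
            insert j (Finset.univ.filter fun i : Fin (A.rk a) => i.1 < k) := by
          ext i
          simp [j, Fin.ext_iff]
          omega
        rw [this, Finset.sum_insert (by simp [j]), ← h₃, add_comm, List.map_append,
          ← Multiset.coe_add]
        simpa [Function.comp_def] using List.perm_append_comm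
      · intro x hx
        rcases List.mem_append.1 hx with hx | hx
        · obtain ⟨i, w, hi, hik⟩ := h₄ x hx
          exact ⟨i, w, hi, by omega⟩
        · obtain ⟨y, -, rfl⟩ := List.mem_map.1 hx
          exact ⟨_, _, rfl, le_rfl⟩
  obtain ⟨d, h₁, h₂, h₃, h₄⟩ := key _ le_rfl
  refine ⟨d, h₁, by simpa using h₂, by simpa using h₃, fun x hx h => ?_⟩
  obtain ⟨i, w, hi, -⟩ := h₄ x hx
  simp [hi] at h

/-- Every run comes from a left-most derivation. The last clause makes it possible to append a step
at the root. -/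
theorem Run.exists_derives {t : GroundTree A} {ξ : RTree A G.N} {m : Multiset G.prods}
    (h : G.Run t ξ m) : ∃ d : List (G.prods × List ℕ), d.Pairwise (fun x y => PosLT x.2 y.2) ∧
      G.Derives t t.ofGround d ξ ∧ (d.map Prod.fst : Multiset G.prods) = m ∧
      ((∀ q, ξ ≠ .leaf q) → ∀ x ∈ d, x.2 ≠ []) := by
  induction h with
  | node a ts ξs ms _ ih =>
    choose ds h₁ h₂ h₃ _ using ih
    obtain ⟨d, hd₁, hd₂, hd₃, hd₄⟩ := exists_derives_node ts _ ξs ds h₁ h₂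
    exact ⟨d, hd₁, hd₂, by simp [hd₃, h₃], fun _ => hd₄⟩
  | prod t p m _ hE hI ih =>
    obtain ⟨d, h₁, h₂, h₃, h₄⟩ := ih
    refine ⟨d ++ [(p, [])], ?_, ?_, ?_, fun h => (h _ rfl).elim⟩
    · rw [List.pairwise_append]
      refine ⟨h₁, by simp, fun x hx y hy => ?_⟩
      obtain rfl := List.mem_singleton.1 hy
      obtain ⟨i, w, hw⟩ := List.exists_cons_of_ne_nil (h₄ p.1.lhs_ne_leaf x hx)
      rw [hw]
      trivial
    · exact h₂.append (.cons ⟨subtreeAt_nil _, (replaceAt_nil _ _).symm, t, subtreeAt_nil _, hE, hI⟩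
        (.nil _))
    · rw [← h₃, List.map_append, ← Multiset.coe_add, add_comm]
      simp

/-! ### Weights of runs -/

section Weight

variable [CommSemiring S]

/-- The product of the weights of the productions in `m`. -/
def weight (G : WTGc A S) (m : Multiset G.prods) : S := (m.map G.wt).prod

theorem derivationWeight_eq (d : List (G.prods × List ℕ)) :
    G.derivationWeight d = G.weight (d.map Prod.fst : Multiset G.prods) := by
  simp [derivationWeight, weight, Function.comp_def]

theorem weight_dvd_weight {m m' : Multiset G.prods} (h : m ≤ m') : G.weight m ∣ G.weight m' :=
  Multiset.prod_dvd_prod_of_le (Multiset.map_le_map h)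

theorem weight_sum {ι : Type*} (s : Finset ι) (m : ι → Multiset G.prods) :
    G.weight (∑ i ∈ s, m i) = ∏ i ∈ s, G.weight (m i) := by
  classical
  induction s using Finset.induction_on with
  | empty => simp [weight]
  | insert i s hi ih =>
    rw [Finset.sum_insert hi, Finset.prod_insert hi, ← ih]
    simp [weight]

theorem exists_run_of_language_ne_zero {t : GroundTree A} (h : G.language t ≠ 0) :
    ∃ q m, G.Run t (.leaf q) m ∧ G.final q * G.weight m ≠ 0 := by
  let _ := G.fintypeN
  obtain ⟨q, -, hq⟩ := Finset.exists_ne_zero_of_sum_ne_zero h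
  obtain ⟨d, hd, hw⟩ := Finset.exists_ne_zero_of_sum_ne_zero hq
  refine ⟨q, _, ?_, derivationWeight_eq d ▸ hw⟩
  simpa using ((Set.Finite.mem_toFinset _).1 hd).2.run (run_ofGround t)

theorem _root_.IsZeroSumFree.sum_ne_zero (hS : IsZeroSumFree S) {ι : Type*} {s : Finset ι}
    {f : ι → S} {i : ι} (hi : i ∈ s) (h : f i ≠ 0) : ∑ j ∈ s, f j ≠ 0 := by
  classical
  rw [← Finset.add_sum_erase _ _ hi]
  exact fun h' => h (hS _ _ h').1

theorem Run.language_ne_zero (hS : IsZeroSumFree S) {t : GroundTree A} {q : G.N}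
    {m : Multiset G.prods} (h : G.Run t (.leaf q) m) (hw : G.final q * G.weight m ≠ 0) :
    G.language t ≠ 0 := by
  let _ := G.fintypeN
  obtain ⟨d, h₁, h₂, rfl, -⟩ := h.exists_derives
  refine hS.sum_ne_zero (Finset.mem_univ q) (hS.sum_ne_zero (i := d) ?_ ?_)
  · exact (Set.Finite.mem_toFinset _).2 ⟨h₁, h₂⟩
  · rwa [derivationWeight_eq]

theorem weight_leafSum_dvd (l : RTree A G.N) {μ μ' : List ℕ → Multiset G.prods}
    (h : ∀ w q, l.subtreeAt w = some (.leaf q) → G.weight (μ' w) ∣ G.weight (μ w)) :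
    G.weight (l.leafSum μ') ∣ G.weight (l.leafSum μ) := by
  induction l generalizing μ μ' with
  | leaf q => exact h [] q rfl
  | node a ts ih =>
    simp only [leafSum, weight_sum]
    refine Finset.prod_dvd_prod_of_dvd _ _ fun i _ => ih i fun w q hw => h _ q ?_
    rwa [subtreeAt_node_succ]

/-- Every tree is reduced to a sink nonterminal by a run of weight `1`. -/
theorem IsSinkNonterminal.exists_run {b : G.N} (hb : G.IsSinkNonterminal b) (t : GroundTree A) :
    ∃ m, G.Run t (.leaf b) m ∧ G.weight m = 1 := by
  induction t with
  | leaf e => exact e.elim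
  | node a ts ih =>
    choose ms h₁ h₂ using ih
    obtain ⟨h, hw⟩ := hb.2.1 a
    refine ⟨⟨_, h⟩ ::ₘ ∑ i, ms i, Run.prod _ ⟨_, h⟩ _ (Run.node a ts _ ms h₁) ?_ ?_, ?_⟩
    · simp [WTGcProduction.sink]
    · simp [WTGcProduction.sink]
    · have := weight_sum Finset.univ ms
      rw [weight, Multiset.map_cons, Multiset.prod_cons, hw, one_mul]
      exact this.trans (by simp [h₂])

end Weight

/-! ### Decomposition of runs at a left-hand side -/

/-- A run to `l` splits into runs to the nonterminals at the leaves of `l`. -/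
theorem Run.exists_plug {t : GroundTree A} {l : RTree A G.N} {m : Multiset G.prods}
    (h : G.Run t l m) : ∃ (τ : List ℕ → GroundTree A) (μ : List ℕ → Multiset G.prods),
      t = l.plug τ ∧ m = l.leafSum μ ∧
      ∀ w q, l.subtreeAt w = some (.leaf q) → G.Run (τ w) (.leaf q) (μ w) := by
  induction l generalizing t m with
  | leaf q =>
    refine ⟨fun _ => t, fun _ => m, rfl, rfl, ?_⟩
    rintro (_ | ⟨i, w⟩) q' hw
    · cases hw
      exact h
    · simp [subtreeAt] at hw
  | node a ls ih =>
    obtain ⟨ts, ms, rfl, rfl, hrun⟩ := h.exists_of_node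
    choose τs μs h₁ h₂ h₃ using fun i => ih i (hrun i)
    -- positions that do not start with the index of a child are irrelevant
    refine ⟨fun w => if hi : w.headD 0 - 1 < A.rk a then τs ⟨_, hi⟩ w.tail else .node a ts,
      fun w => if hi : w.headD 0 - 1 < A.rk a then μs ⟨_, hi⟩ w.tail else 0, ?_, ?_, ?_⟩
    · simp [plug, ← h₁]
    · simp [leafSum, ← h₂]
    · rintro (_ | ⟨i, w⟩) q hw
      · simp [subtreeAt] at hw
      · obtain ⟨a', ls', he, j, rfl, hw⟩ := exists_of_subtreeAt_cons hw
        cases he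
        simpa using h₃ j w q hw

/-- Runs to the nonterminals at the leaves of `l` combine to a run to `l`. -/
theorem run_plug {l : RTree A G.N} {τ : List ℕ → GroundTree A} {μ : List ℕ → Multiset G.prods}
    (h : ∀ w q, l.subtreeAt w = some (.leaf q) → G.Run (τ w) (.leaf q) (μ w)) :
    G.Run (l.plug τ) l (l.leafSum μ) := by
  induction l generalizing τ μ with
  | leaf q => exact h [] q rfl
  | node a ls ih =>
    refine Run.node a _ _ _ fun i => ih i fun w q hw => h _ q ?_
    rwa [subtreeAt_node_succ]

end WTGc

/-! ### Alternating trees -/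

open RTree

/-- The two symbols with the constraint `12 = 21`. -/
def altSym : Bool → witnessAlphabet.Sym
  | true => WitnessSym.f
  | false => WitnessSym.fUnderlined

theorem witnessAlphabet_rk_altSym (b : Bool) : witnessAlphabet.rk (altSym b) = 2 := by
  cases b <;> rfl

/-- The tree `g(a, a)`. -/
def baseTree : GroundTree witnessAlphabet :=
  .node (A := witnessAlphabet) .g fun _ => .node (A := witnessAlphabet) .a Fin.elim0

/-- The full binary tree with `n` levels of `f` and `f̲` above `g(a, a)`: the root symbol is given by
`b`, a first child has the symbol of its parent, and a second child has the other one. -/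
def altTree : ℕ → Bool → GroundTree witnessAlphabet
  | 0, _ => baseTree
  | n + 1, b => .node (altSym b) fun i =>
      altTree n (if i.1 = 0 then b else !b)

theorem altTree_subtreeAt_one (n : ℕ) (b : Bool) :
    (altTree (n + 1) b).subtreeAt [1] = some (altTree n b) := by
  simp [altTree, subtreeAt, subtreeAt_nil, witnessAlphabet_rk_altSym]

theorem altTree_subtreeAt_two (n : ℕ) (b : Bool) :
    (altTree (n + 1) b).subtreeAt [2] = some (altTree n !b) := by
  simp [altTree, subtreeAt, subtreeAt_nil, witnessAlphabet_rk_altSym]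

theorem altTree_height_injective {n m : ℕ} {b c : Bool} (h : altTree n b = altTree m c) :
    n = m := by
  induction n generalizing m b c with
  | zero =>
    cases m with
    | zero => rfl
    | succ m => cases c <;> cases h
  | succ n ih =>
    cases m with
    | zero => cases b <;> cases h
    | succ m =>
      have := congrArg (fun t => t.subtreeAt [1]) h
      simp only [altTree_subtreeAt_one, Option.some.injEq] at this
      rw [ih this]

theorem altTree_ne_altTree_not (n : ℕ) (b : Bool) : altTree (n + 1) b ≠ altTree (n + 1) !b := by
  intro h
  simp only [altTree] at h
  injection h with h
  cases b <;> cases h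

/-- Both subtrees compared by the constraint `12 = 21` have the symbol opposite to `b` at the
root. -/
theorem altTree_satisfies (n : ℕ) (b : Bool) :
    (altTree (n + 1) b).Satisfies ([1, 2], [2, 1]) := by
  cases n with
  | zero =>
    refine ⟨.node (A := witnessAlphabet) .a Fin.elim0, ?_, ?_⟩ <;> cases b <;>
      simp [altTree, baseTree, subtreeAt, witnessAlphabet, altSym]
  | succ n =>
    refine ⟨altTree n !b, ?_, ?_⟩
    · rw [show [1, 2] = [1] ++ [2] from rfl, subtreeAt_append, altTree_subtreeAt_one]
      exact altTree_subtreeAt_two _ _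
    · rw [show [2, 1] = [2] ++ [1] from rfl, subtreeAt_append, altTree_subtreeAt_two]
      exact altTree_subtreeAt_one _ _

/-- If an alternating tree is sufficiently higher than `l` and has the shape of `l`, then some two
siblings in `l` are both leaves of `l`, and they lie strictly above the symbols `g` of the
alternating tree. -/
theorem exists_sibling_leaves {Z : Type} (l : RTree witnessAlphabet Z) (hl : ∀ z, l ≠ .leaf z) :
    ∃ (u : List ℕ) (K : ℕ), ∀ n ≥ K, ∀ b τ, altTree n b = l.plug τ →
      ∃ k c, n = k + 2 + u.length ∧ (altTree n b).subtreeAt u = some (altTree (k + 2) c) ∧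
        (∃ z, l.subtreeAt (u ++ [1]) = some (.leaf z)) ∧
        ∃ z, l.subtreeAt (u ++ [2]) = some (.leaf z) := by
  induction l with
  | leaf z => exact (hl z rfl).elim
  | node σ ls ih =>
    by_cases h : ∃ i, ∀ z, ls i ≠ .leaf z
    · obtain ⟨i, hi⟩ := h
      obtain ⟨u, K, hK⟩ := ih i hi
      refine ⟨(i.1 + 1) :: u, K + 1, fun n hn b τ he => ?_⟩
      obtain ⟨n, rfl⟩ : ∃ n', n = n' + 1 := ⟨n - 1, by omega⟩
      simp only [altTree, plug] at he
      injection he with hσ he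
      subst hσ
      obtain ⟨k, c, hk, h₁, h₂, h₃⟩ := hK n (by omega) _ _ (congrFun (eq_of_heq he) i)
      refine ⟨k, c, by simp; omega, ?_, ?_, ?_⟩
      · rw [altTree, subtreeAt_node_succ, h₁]
      · rwa [List.cons_append, subtreeAt_node_succ]
      · rwa [List.cons_append, subtreeAt_node_succ]
    · push Not at h
      refine ⟨[], 2, fun n hn b τ he => ?_⟩
      obtain ⟨n, rfl⟩ : ∃ n', n = n' + 2 := ⟨n - 2, by omega⟩
      simp only [altTree, plug] at he
      injection he with hσ _
      subst hσ
      refine ⟨n, b, by simp, subtreeAt_nil _, ?_, ?_⟩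
      · obtain ⟨z, hz⟩ := h ⟨0, by rw [witnessAlphabet_rk_altSym]; omega⟩
        exact ⟨z, by simp [subtreeAt, witnessAlphabet_rk_altSym, hz]⟩
      · obtain ⟨z, hz⟩ := h ⟨1, by rw [witnessAlphabet_rk_altSym]; omega⟩
        exact ⟨z, by simp [subtreeAt, witnessAlphabet_rk_altSym, hz]⟩

/-! ### The language of the witness grammar -/

section WitnessGrammar

variable {S : Type*} [CommSemiring S]

theorem witnessGrammar_isPositive : (witnessGrammar S).IsPositive := by
  rintro p (rfl | rfl | rfl | rfl) <;> rfl

theorem exists_run_altTree (n : ℕ) (b : Bool) :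
    ∃ m, (witnessGrammar S).Run (altTree n b) (.leaf WitnessNT.q) m := by
  induction n generalizing b with
  | zero =>
    let pa : (witnessGrammar S).prods := ⟨witnessProduction .a .q .q' ∅, Or.inl rfl⟩
    let pg : (witnessGrammar S).prods := ⟨witnessProduction .g .q' .q ∅, Or.inr (Or.inl rfl)⟩
    refine ⟨_, WTGc.Run.prod _ pg _ (WTGc.Run.node (A := witnessAlphabet) .g _ _ _ fun _ =>
      WTGc.Run.prod _ pa _ (WTGc.Run.node (A := witnessAlphabet) .a _ _ (fun _ => 0)
        fun i => i.elim0) ?_ ?_) ?_ ?_⟩ <;> simp [pa, pg, witnessProduction]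
  | succ n ih =>
    choose m hm using ih
    have hp : witnessProduction (altSym b : WitnessSym) .q .q {([1, 2], [2, 1])} ∈
        (witnessGrammar S).prods := by
      cases b
      · exact Or.inr (Or.inr (Or.inr rfl))
      · exact Or.inr (Or.inr (Or.inl rfl))
    refine ⟨_, WTGc.Run.prod _ ⟨_, hp⟩ _ (WTGc.Run.node (altSym b) _ _ _
      fun i => hm _) ?_ ?_⟩
    · simpa [witnessProduction] using altTree_satisfies n b
    · simp [witnessProduction]

theorem witnessGrammar_language_altTree_ne_zero [Nontrivial S] (hS : IsZeroSumFree S) (n : ℕ)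
    (b : Bool) : (witnessGrammar S).language (altTree n b) ≠ 0 := by
  obtain ⟨m, hm⟩ := exists_run_altTree (S := S) n b
  refine hm.language_ne_zero hS ?_
  have hw : (witnessGrammar S).weight m = 1 :=
    Multiset.prod_eq_one fun x hx => by
      obtain ⟨_, -, rfl⟩ := Multiset.mem_map.1 hx
      rfl
  rw [hw, mul_one]
  exact one_ne_zero

/-- In a tree generated by the witness grammar the constraint `12 = 21` holds at each position above
a symbol `f` or `f̲`. -/
theorem WTGc.Run.subtreeAt_eq {t : GroundTree witnessAlphabet} {r : WitnessNT}
    {m : Multiset (witnessGrammar S).prods} (h : (witnessGrammar S).Run t (.leaf r) m)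
    {u : List ℕ} {c : Bool} {ts : Fin (witnessAlphabet.rk (altSym c)) → GroundTree witnessAlphabet}
    (hu : t.subtreeAt (u ++ [1]) = some (.node (altSym c) ts)) :
    t.subtreeAt (u ++ [1, 2]) = t.subtreeAt (u ++ [2, 1]) := by
  induction u generalizing t r m with
  | nil =>
    obtain ⟨⟨p, hp⟩, m', -, -, h, hE, -⟩ := h.exists_of_leaf
    rcases hp with rfl | rfl | rfl | rfl
    · obtain ⟨ts', ms, rfl, -, -⟩ := h.exists_of_node
      simp [subtreeAt, witnessAlphabet] at hu
    · obtain ⟨ts', ms, rfl, -, hrun⟩ := h.exists_of_node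
      -- the children of `g` are reduced to `q'`, and only `a` is
      obtain ⟨⟨p, hp⟩, m'', ht, -, h', -, -⟩ := (hrun ⟨0, Nat.zero_lt_two⟩).exists_of_leaf
      have he : ts' ⟨0, Nat.zero_lt_two⟩ = .node (altSym c) ts := by
        rw [← Option.some.injEq, ← hu, ← subtreeAt_nil (ts' _)]
        exact (subtreeAt_node_succ (A := witnessAlphabet) _ ts' ⟨0, Nat.zero_lt_two⟩ []).symm
      rcases hp with rfl | rfl | rfl | rfl
      · obtain ⟨ts'', ms', he', -, -⟩ := h'.exists_of_node
        rw [he] at he'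
        cases c <;> cases he'
      · cases ht
      · cases ht
      · cases ht
    · exact (hE _ (Finset.mem_singleton_self _)).subtreeAt_eq
    · exact (hE _ (Finset.mem_singleton_self _)).subtreeAt_eq
  | cons i u ih =>
    obtain ⟨σ, ts', rfl, j, rfl, hj⟩ := exists_of_subtreeAt_cons hu
    obtain ⟨⟨p, hp⟩, m', -, -, h, -, -⟩ := h.exists_of_leaf
    simp only [List.cons_append, subtreeAt_node_succ]
    rcases hp with rfl | rfl | rfl | rfl <;>
    · obtain ⟨ts'', ms, he, -, hrun⟩ := h.exists_of_node
      cases he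
      exact ih (hrun j) hj

end WitnessGrammar

/-! ### Exchange of subtrees in eq-restricted grammars -/

theorem WTGcProduction.EqClosure.subtreeAt_eq {A : RankedAlphabet} {N : Type}
    {p : WTGcProduction A N} {t : GroundTree A} (ht : ∀ c ∈ p.eqs, t.Satisfies c) {v w : List ℕ}
    (h : p.EqClosure v w) : t.subtreeAt v = t.subtreeAt w := by
  induction h with
  | rel v w h => exact (ht _ h).subtreeAt_eq
  | refl => rfl
  | symm _ _ _ ih => exact ih.symm
  | trans _ _ _ _ _ ih₁ ih₂ => exact ih₁.trans ih₂

namespace WTGc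

variable {A : RankedAlphabet} {S : Type*}

open Classical in
/-- In a run that ends with an application of an eq-restricted production, the subtrees at the
positions of one class can be replaced by any tree `s` that is reduced to the nonterminal `q'` of
the class: the other positions of the class are labeled by the sink nonterminal, and so they
contribute the factor `1` to the weight of the new run. -/
theorem Run.exchange [CommSemiring S] {G : WTGc A S} {b : G.N} (hb : G.IsSinkNonterminal b)
    {p : G.prods} (hpos : p.1.IsPositive) (hclassic : p.1.IsClassic) {v₀ v : List ℕ} {q' : G.N}
    (hlabel : ∀ w, p.1.EqClosure v₀ w → p.1.NonterminalAt w q' ∨ p.1.NonterminalAt w b)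
    (huniq : ∀ w, p.1.EqClosure v₀ w → p.1.NonterminalAt w q' → w = v)
    {τ : List ℕ → GroundTree A} {μ : List ℕ → Multiset G.prods}
    (hrun : ∀ w q, p.1.NonterminalAt w q → G.Run (τ w) (.leaf q) (μ w))
    (heqs : ∀ c ∈ p.1.eqs, (p.1.lhs.plug τ).Satisfies c) {s : GroundTree A}
    {e : Multiset G.prods} (hs : G.Run s (.leaf q') e) (he : G.weight e ∣ G.weight (μ v)) :
    ∃ m, G.Run (p.1.lhs.plug fun w => if p.1.EqClosure v₀ w then s else τ w)
        (.leaf p.1.target) m ∧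
      G.weight m ∣ G.weight (p ::ₘ p.1.lhs.leafSum μ) := by
  obtain ⟨z, hz, hz₁⟩ := hb.exists_run s
  refine ⟨p ::ₘ p.1.lhs.leafSum fun w =>
    if p.1.EqClosure v₀ w then if p.1.NonterminalAt w q' then e else z else μ w,
    Run.prod _ p _ (run_plug fun w q hw => ?_) ?_ ?_, ?_⟩
  · split_ifs with hc hq
    · rwa [RTree.leaf.inj (Option.some.inj (hw.symm.trans hq))]
    · have hq := (hlabel w hc).resolve_left hq
      rwa [RTree.leaf.inj (Option.some.inj (hw.symm.trans hq))]
    · exact hrun w q hw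
  · intro c hc
    obtain ⟨⟨q₁, h₁⟩, ⟨q₂, h₂⟩⟩ := hclassic c (Or.inl hc)
    refine ⟨_, subtreeAt_plug _ h₁, ?_⟩
    rw [subtreeAt_plug _ h₂]
    have hrel : p.1.EqClosure c.1 c.2 := Relation.EqvGen.rel _ _ hc
    have hiff : p.1.EqClosure v₀ c.1 ↔ p.1.EqClosure v₀ c.2 :=
      ⟨fun h => .trans _ _ _ h hrel, fun h => .trans _ _ _ h (.symm _ _ hrel)⟩
    have heq := (heqs c hc).subtreeAt_eq
    rw [subtreeAt_plug _ h₁, subtreeAt_plug _ h₂, Option.some.injEq] at heq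
    simp only [hiff, heq]
  · simp [show p.1.neqs = ∅ from hpos]
  · rw [weight, weight, Multiset.map_cons, Multiset.map_cons, Multiset.prod_cons,
      Multiset.prod_cons]
    refine mul_dvd_mul_left _ (weight_leafSum_dvd _ fun w q hw => ?_)
    split_ifs with hc hq
    · rwa [huniq w hc hq]
    · simp [hz₁]
    · rfl

/-- By Dickson's lemma, multisets of productions are well-quasi-ordered by inclusion. -/
theorem exists_lt_multiset_le (G : WTGc A S) (m : ℕ → Multiset G.prods) :
    ∃ i j, i < j ∧ m i ≤ m j := by
  classical
  have : Finite G.prods := G.finite_prods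
  obtain ⟨i, j, hij, h⟩ := wellQuasiOrdered_le fun n (p : G.prods) => (m n).count p
  exact ⟨i, j, hij, Multiset.le_iff_count.2 h⟩

end WTGc

/-! ### Separation of the two classes -/

/-- An eq-restricted grammar for the language of the witness grammar would also generate a tree in
which the subtrees at the positions `u12` and `u21` have different heights for some `u`. -/
theorem witnessLanguage_not_mem {S : Type*} [CommSemiring S] [Nontrivial S]
    (hS : IsZeroSumFree S) :
    (⟨witnessAlphabet, (witnessGrammar S).language⟩ : WeightedTreeLanguage S) ∉
      eqRestrictedPositiveClassic S := by
  classical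
  rintro ⟨G, ⟨-, b, hb, hrestr⟩, hpos, hclassic, hG⟩
  change G.language = (witnessGrammar S).language at hG
  -- the last production `p n` of a run on `altTree n true`, and the runs below it
  have hdata : ∀ n, ∃ (p : G.prods) (τ : List ℕ → GroundTree witnessAlphabet)
      (μ : List ℕ → Multiset G.prods), altTree n true = p.1.lhs.plug τ ∧
      (∀ w q, p.1.NonterminalAt w q → G.Run (τ w) (.leaf q) (μ w)) ∧
      (∀ c ∈ p.1.eqs, (altTree n true).Satisfies c) ∧
      G.final p.1.target * G.weight (p ::ₘ p.1.lhs.leafSum μ) ≠ 0 := by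
    intro n
    have hn := witnessGrammar_language_altTree_ne_zero hS n true
    rw [← hG] at hn
    obtain ⟨q, m, h, hw⟩ := WTGc.exists_run_of_language_ne_zero hn
    obtain ⟨p, m', rfl, rfl, h, hE, -⟩ := h.exists_of_leaf
    obtain ⟨τ, μ, hτ, rfl, hrun⟩ := h.exists_plug
    exact ⟨p, τ, μ, hτ, hrun, hE, hw⟩
  choose p τ μ hτ hrun heqs hw using hdata
  have : Finite G.prods := G.finite_prods
  obtain ⟨p₀, hinf⟩ := Finite.exists_infinite_fiber p
  obtain ⟨u, K, hK⟩ := exists_sibling_leaves p₀.1.lhs p₀.1.lhs_ne_leaf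
  have hinf : {n | p n = p₀ ∧ K ≤ n}.Infinite := by
    refine ((Set.infinite_coe_iff.1 hinf).sdiff (Set.finite_lt_nat K)).mono ?_
    rintro n ⟨hn, hn'⟩
    exact ⟨hn, not_lt.1 hn'⟩
  let φ := Nat.nth fun n => p n = p₀ ∧ K ≤ n
  have hφ : ∀ i, p (φ i) = p₀ ∧ K ≤ φ i := Nat.nth_mem_of_infinite hinf
  -- the two sibling leaves `u1` and `u2` exist for every tree in the sequence
  have hsib : ∀ i, ∃ k c, φ i = k + 2 + u.length ∧
      (altTree (φ i) true).subtreeAt u = some (altTree (k + 2) c) ∧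
      (∃ z, p₀.1.NonterminalAt (u ++ [1]) z) ∧ ∃ z, p₀.1.NonterminalAt (u ++ [2]) z := fun i =>
    hK _ (hφ i).2 true (τ (φ i)) ((hφ i).1 ▸ hτ (φ i))
  choose k c hk hsub hleft hright using hsib
  obtain ⟨q', hlabel, v, ⟨hv, hvq⟩, huniq⟩ := hrestr p₀.1 p₀.2 _ (hleft 0)
  have H : ∀ i, altTree (φ i) true = p₀.1.lhs.plug (τ (φ i)) ∧
      (∀ w q, p₀.1.NonterminalAt w q → G.Run (τ (φ i) w) (.leaf q) (μ (φ i) w)) ∧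
      (∀ e ∈ p₀.1.eqs, (altTree (φ i) true).Satisfies e) ∧
      G.final p₀.1.target * G.weight (p₀ ::ₘ p₀.1.lhs.leafSum (μ (φ i))) ≠ 0 := by
    intro i
    rw [← (hφ i).1]
    exact ⟨hτ _, hrun _, heqs _, hw _⟩
  have hone : ∀ i, (altTree (φ i) true).subtreeAt (u ++ [1]) = some (altTree (k i + 1) (c i)) := by
    intro i
    rw [subtreeAt_append, hsub]
    exact altTree_subtreeAt_one _ _
  have htwo : ∀ i, (altTree (φ i) true).subtreeAt (u ++ [2]) = some (altTree (k i + 1) !(c i)) := by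
    intro i
    rw [subtreeAt_append, hsub]
    exact altTree_subtreeAt_two _ _
  have hτv : ∀ i, τ (φ i) v = altTree (k i + 1) (c i) := by
    intro i
    have h := (hv.subtreeAt_eq (H i).2.2.1).symm.trans (hone i)
    rwa [(H i).1, subtreeAt_plug _ hvq, Option.some.injEq] at h
  obtain ⟨i, j, hij, hle⟩ := G.exists_lt_multiset_le fun i => μ (φ i) v
  have hs := (H i).2.1 v q' hvq
  rw [hτv] at hs
  obtain ⟨hj₁, hj₂, hj₃, hj₄⟩ := H j
  obtain ⟨m, hm, hdvd⟩ := WTGc.Run.exchange hb (hpos _ p₀.2) (hclassic _ p₀.2) hlabel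
    (fun w h h' => huniq w ⟨h, h'⟩) hj₂ (fun e he => hj₁ ▸ hj₃ e he) hs (WTGc.weight_dvd_weight hle)
  -- the tree obtained by the exchange is generated by the witness grammar as well
  have hne : G.final p₀.1.target * G.weight m ≠ 0 := fun h0 =>
    hj₄ (zero_dvd_iff.1 (h0 ▸ mul_dvd_mul_left _ hdvd))
  have hlang := hm.language_ne_zero hS hne
  rw [hG] at hlang
  obtain ⟨r, m', hr, -⟩ := WTGc.exists_run_of_language_ne_zero hlang
  obtain ⟨z₁, hz₁⟩ := hleft 0
  obtain ⟨z₂, hz₂⟩ := hright 0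
  have hnot : ¬ p₀.1.EqClosure (u ++ [1]) (u ++ [2]) := fun h => by
    have h := h.subtreeAt_eq hj₃
    rw [hone, htwo, Option.some.injEq] at h
    exact altTree_ne_altTree_not _ _ h
  have hτ₂ : τ (φ j) (u ++ [2]) = altTree (k j + 1) !(c j) := by
    have h := htwo j
    rwa [hj₁, subtreeAt_plug _ hz₂, Option.some.injEq] at h
  have h₁ := subtreeAt_plug (fun w => if p₀.1.EqClosure (u ++ [1]) w then altTree (k i + 1) (c i)
    else τ (φ j) w) hz₁
  have h₂ := subtreeAt_plug (fun w => if p₀.1.EqClosure (u ++ [1]) w then altTree (k i + 1) (c i)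
    else τ (φ j) w) hz₂
  have hrefl : p₀.1.EqClosure (u ++ [1]) (u ++ [1]) := .refl _
  rw [if_pos hrefl] at h₁
  rw [if_neg hnot, hτ₂] at h₂
  -- but it violates the constraint at the position `u`
  have h := hr.subtreeAt_eq h₁
  rw [show u ++ [1, 2] = u ++ [1] ++ [2] by simp, show u ++ [2, 1] = u ++ [2] ++ [1] by simp,
    subtreeAt_append _ (u ++ [1]), subtreeAt_append _ (u ++ [2]), h₁, h₂, Option.bind_some,
    Option.bind_some, altTree_subtreeAt_one, altTree_subtreeAt_two, Option.some.injEq] at h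
  have hkij := altTree_height_injective h
  have : φ i < φ j := Nat.nth_strictMono hinf hij
  have := hk i
  have := hk j
  omega

theorem mainTheorem3 {S : Type*} [CommSemiring S] [Nontrivial S] (hS : IsZeroSumFree S) :
    eqRestrictedPositiveClassic S ⊂ positiveConstraintRegular S ∧
    (witnessGrammar S).IsPositive ∧
    (⟨witnessAlphabet, (witnessGrammar S).language⟩ : WeightedTreeLanguage S) ∉
      eqRestrictedPositiveClassic S := by
  refine ⟨⟨?_, fun h => ?_⟩, witnessGrammar_isPositive, witnessLanguage_not_mem hS⟩
  · rintro L ⟨G, -, hG, -, hL⟩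
    exact ⟨G, hG, hL⟩
  · exact witnessLanguage_not_mem hS (h ⟨witnessGrammar S, witnessGrammar_isPositive, rfl⟩)
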